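/- Let $k$ be a commutative ring, $\mathfrak J$ a set of representations $I$ with $\dim V_I=d_I<\infty$ and fixed ordered bases, and let $R_+^{IJ}$ ($I,J\in\mathfrak J$) be invertible numerical matrices on $V_I\otimes V_J$, for instance the $R$-matrices of $U_q(\mathcal G)$ (the Yang–Baxter equation is not needed below). Put $R_-^{IJ}=P(R_+^{JI})^{-1}P$, $P$ the permutation. A "matrix" $X$ over an algebra $A$ is a family $X=(X^I)_{I}$ of $d_I\times d_I$ matrices over $A$, $X^1=X^I\otimes1$, $X^2=1\otimes X^J$; all relations are required for all $I,J$. Consider $$(\ast)\qquad R_-X^1R_-^{-1}X^2=X^2R_+X^1R_+^{-1}.$$ Gauss components of a matrix $X$ are matrices $X_+$ (upper triangular) and $X_-$ (lower triangular) with mutually inverse diagonals such that $X=X_+X_-^{-1}$, $R_\pm X_\pm^1X_\pm^2=X_\pm^2X_\pm^1R_\pm$, $R_+X_+^1X_-^2=X_-^2X_+^1R_+$, and such that every element of $A$ commuting with all entries of $X$ commutes with all entries of $X_\pm$. For $m\ge0$ let $\mathcal L_m$ be the universal $k$-algebra generated by the entries of matrices $L_1,\dots,L_m$ and of their Gauss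 components $L_\pm(i)$, where each $L_i$ satisfies $(\ast)$ and $L_i^1L_j^2=L_j^2L_i^1$ for $i\ne j$. Let $\mathcal F_{0,m}$ be the universal $k$-algebra generated by the entries of matrices $M_1,\dots,M_m$, each satisfying $(\ast)$, with $$R_+M_i^1R_+^{-1}M_j^2=M_j^2R_+M_i^1R_+^{-1}\qquad(i<j),$$ into which Gauss components are introduced successively: for $i=1,\dots,m$ there are a matrix $N_i$ with $\kappa_iN_i=M_i\kappa_i$, where $\kappa_i=N_-(1)\cdots N_-(i-1)$, and matrices $N_\pm(i)$, which are Gauss components of $N_i$ provided that $N_i$ satisfies $(\ast)$. (Universal means: the free algebra on the entries of all the named matrices modulo the smallest congruence for which all the stated conditions hold in the quotient.) The subalgebra of $\mathcal F_{0,m}$ generated by the monodromies $M_i$ is understood as the smallest subalgebra which contains the entries of all $M_i$ and which, with the entries of any matrix satisfying $(\ast)$, contains the entries of its Gauss components. **Theorem.** Let $n,g\ge0$, $m=n+2g$. In $\mathcal L_m$ the matrices $L_-(i)$ and $K_i=L_-(1)\cdots L_-(i-1)$ ($1\le i\le m+1$, $K_1=1$) are invertible and $L_i=L_+(i)L_-(i)^{-1}$.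 There is an isomorphism of $k$-algebras from $\mathcal L_m$ onto the subalgebra of $\mathcal F_{0,m}$ generated by the monodromies $M_i$, under which $$M_i=K_iL_iK_i^{-1}\qquad(i=1,\dots,m).$$ Moreover, under this isomorphism the spectral dependent monodromies $M_i(\lambda)=M_i+\lambda\,1$ are gauge equivalent to the XXZ $L$-operators: for all $\lambda\in k$, $$M_i(\lambda)=K_i\,\bigl(L_+(i)+\lambda L_-(i)\bigr)\,K_{i+1}^{-1}\qquad(i=1,\dots,m).$$ -/

import Mathlib

open scoped Kronecker

noncomputable section

namespace ChernSimons

variable {k : Type*} [CommRing k] {𝔍 : Type*}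

/-- The set `𝔍` labels the representations that are used and `d I` is the dimension of the
representation `I`. A monodromy is a collection of square matrices `X^I`, one for each `I : 𝔍`,
with entries in a (noncommutative) algebra `A`. Rows and columns are indexed by an ordered
weight basis, so that "upper triangular" and "lower triangular" make sense. -/
abbrev Mono (d : 𝔍 → ℕ) (A : Type*) := ∀ I : 𝔍, Matrix (Fin (d I)) (Fin (d I)) A

/-- A family of invertible numerical matrices `R^{IJ}` acting on `V_I ⊗ V_J`, for example the
values of the universal `R`-matrix of `U_q(𝒢)` in the representations `I` and `J`. -/
abbrev RFamily (k : Type*) [CommRing k] (d : 𝔍 → ℕ) :=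
  ∀ I J : 𝔍, (Matrix (Fin (d I) × Fin (d J)) (Fin (d I) × Fin (d J)) k)ˣ

variable {d : 𝔍 → ℕ}

/-- `R_+^{IJ} = R^{IJ}`, as a matrix with entries in the `k`-algebra `A`. -/
def Rplus (R : RFamily k d) (A : Type*) [Ring A] [Algebra k A] (I J : 𝔍) :
    (Matrix (Fin (d I) × Fin (d J)) (Fin (d I) × Fin (d J)) A)ˣ :=
  Units.map ((algebraMap k A).mapMatrix : _ →+* _).toMonoidHom (R I J)

/-- `R_-^{IJ} = P (R_+^{JI})⁻¹ P`, where `P` exchanges the two tensor factors. -/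
def Rminus (R : RFamily k d) (A : Type*) [Ring A] [Algebra k A] (I J : 𝔍) :
    (Matrix (Fin (d I) × Fin (d J)) (Fin (d I) × Fin (d J)) A)ˣ :=
  Units.map (Matrix.reindexAlgEquiv ℕ A (Equiv.prodComm (Fin (d J)) (Fin (d I)))
    : _ →ₐ[ℕ] _).toRingHom.toMonoidHom (Rplus R A J I)⁻¹

section Relations

variable {A : Type*} [Ring A] [Algebra k A]

/-- `X¹ = X^I ⊗ 1` on `V_I ⊗ V_J`. -/
def leg₁ (X : Mono d A) (I J : 𝔍) :
    Matrix (Fin (d I) × Fin (d J)) (Fin (d I) × Fin (d J)) A :=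
  X I ⊗ₖ (1 : Matrix (Fin (d J)) (Fin (d J)) A)

/-- `X² = 1 ⊗ X^J` on `V_I ⊗ V_J`. -/
def leg₂ (X : Mono d A) (I J : 𝔍) :
    Matrix (Fin (d I) × Fin (d J)) (Fin (d I) × Fin (d J)) A :=
  (1 : Matrix (Fin (d I)) (Fin (d I)) A) ⊗ₖ X J

/-- The reflection-type relation `R_- X¹ R_-⁻¹ X² = X² R_+ X¹ R_+⁻¹`. -/
def SelfExchange (R : RFamily k d) (X : Mono d A) : Prop :=
  ∀ I J : 𝔍,
    (Rminus R A I J).val * leg₁ X I J * (Rminus R A I J)⁻¹.val * leg₂ X I J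
      = leg₂ X I J * (Rplus R A I J).val * leg₁ X I J * (Rplus R A I J)⁻¹.val

/-- The relation `R_+ X¹ R_+⁻¹ Y² = Y² R_+ X¹ R_+⁻¹`. -/
def CrossExchange (R : RFamily k d) (X Y : Mono d A) : Prop :=
  ∀ I J : 𝔍,
    (Rplus R A I J).val * leg₁ X I J * (Rplus R A I J)⁻¹.val * leg₂ Y I J
      = leg₂ Y I J * (Rplus R A I J).val * leg₁ X I J * (Rplus R A I J)⁻¹.val

/-- `X_+`, `X_-` are Gauss components of `X`: `X = X_+ X_-⁻¹` with `X_+` upper and `X_-` lower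
triangular, with diagonals inverse to each other, and with the quantum group exchange relations.
As `X_-` is triangular with invertible diagonal entries it is invertible, and the factorization
may be written as `X X_- = X_+`. The entries of `X_±` belong to the copy of the quantum group that
is generated by `X`, so an element that commutes with all entries of `X` commutes with them. -/
structure GaussComponents (R : RFamily k d) (X Xp Xm : Mono d A) : Prop where
  upper : ∀ I a b, b < a → Xp I a b = 0
  lower : ∀ I a b, a < b → Xm I a b = 0
  diag_pm : ∀ I a, Xp I a a * Xm I a a = 1
  diag_mp : ∀ I a, Xm I a a * Xp I a a = 1
  factor : ∀ I, X I * Xm I = Xp I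
  exch_pp : ∀ I J, (Rplus R A I J).val * leg₁ Xp I J * leg₂ Xp I J
    = leg₂ Xp I J * leg₁ Xp I J * (Rplus R A I J).val
  exch_mm : ∀ I J, (Rminus R A I J).val * leg₁ Xm I J * leg₂ Xm I J
    = leg₂ Xm I J * leg₁ Xm I J * (Rminus R A I J).val
  exch_pm : ∀ I J, (Rplus R A I J).val * leg₁ Xp I J * leg₂ Xm I J
    = leg₂ Xm I J * leg₁ Xp I J * (Rplus R A I J).val
  commute_of_commute : ∀ x : A, (∀ J a b, Commute x (X J a b)) →
    ∀ I a b, Commute x (Xp I a b) ∧ Commute x (Xm I a b)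

/-- The ordered products `K_i = L_-(1) ⋯ L_-(i-1)`; with sites numbered from `0`, the value at
`r` is the product of the first `r` matrices, so the value at `0` is the unit matrix. -/
def gauge {m : ℕ} (Lm : Fin m → Mono d A) (r : Fin (m + 1)) : Mono d A :=
  fun I => Fin.partialProd (fun j => Lm j I) r

/-- The relations of `ℒ_m`: every `L_i` satisfies the reflection-type relation, different `L_i`
commute, and `L_+(i)`, `L_-(i)` are the Gauss components of `L_i`. -/
structure LRelations (R : RFamily k d) {m : ℕ} (L Lp Lm : Fin m → Mono d A) : Prop where
  self : ∀ i, SelfExchange R (L i)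
  comm : ∀ i j, i ≠ j → ∀ I J,
    leg₁ (L i) I J * leg₂ (L j) I J = leg₂ (L j) I J * leg₁ (L i) I J
  gauss : ∀ i, GaussComponents R (L i) (Lp i) (Lm i)

/-- The relations of `ℱ_{0,m}`: the exchange relations for the monodromies `M_1, …, M_m`. Gauss
components are introduced for `M_1` and, one after the other, for the dressed monodromies
`N_i = K_i⁻¹ M_i K_i`, `K_i = N_-(1) ⋯ N_-(i-1)`. They are only required to be Gauss components
when `N_i` satisfies the reflection-type relation; nothing is required between different `N_i`. -/
structure FRelations (R : RFamily k d) {m : ℕ} (M N Np Nm : Fin m → Mono d A) : Prop where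
  self : ∀ i, SelfExchange R (M i)
  cross : ∀ i j, i < j → CrossExchange R (M i) (M j)
  dressed : ∀ i I, gauge Nm i.castSucc I * N i I = M i I * gauge Nm i.castSucc I
  gauss : ∀ i, SelfExchange R (N i) → GaussComponents R (N i) (Np i) (Nm i)

variable (k) in
/-- The subalgebra generated by a set `s`, where together with a matrix that satisfies the
reflection-type relation its Gauss components are always taken along. -/
def gaussAdjoin (R : RFamily k d) (s : Set A) : Subalgebra k A :=
  sInf {S : Subalgebra k A | s ⊆ S ∧ ∀ X Xp Xm : Mono d A,
    (∀ I a b, X I a b ∈ S) → SelfExchange R X → GaussComponents R X Xp Xm →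
      ∀ I a b, Xp I a b ∈ S ∧ Xm I a b ∈ S}

end Relations

/-- Generators of `ℒ_m`: matrix elements of `L_i`, `L_+(i)`, `L_-(i)`. -/
inductive LGen (d : 𝔍 → ℕ) (m : ℕ) : Type _
  | L (i : Fin m) (I : 𝔍) (a b : Fin (d I))
  | Lp (i : Fin m) (I : 𝔍) (a b : Fin (d I))
  | Lm (i : Fin m) (I : 𝔍) (a b : Fin (d I))

/-- Generators of `ℱ_{0,m}`: matrix elements of `M_i`, of the dressed monodromies `N_i`, and of
the Gauss components `N_+(i)`, `N_-(i)`. -/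
inductive FGen (d : 𝔍 → ℕ) (m : ℕ) : Type _
  | M (i : Fin m) (I : 𝔍) (a b : Fin (d I))
  | N (i : Fin m) (I : 𝔍) (a b : Fin (d I))
  | Np (i : Fin m) (I : 𝔍) (a b : Fin (d I))
  | Nm (i : Fin m) (I : 𝔍) (a b : Fin (d I))

/-- The image in a quotient of the free algebra of the matrix of generators given by `f`. -/
def genMat {G : Type*} (c : RingCon (FreeAlgebra k G)) {m : ℕ}
    (f : ∀ (_ : Fin m) (I : 𝔍) (_ _ : Fin (d I)), G) (i : Fin m) : Mono d c.Quotient :=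
  fun I => Matrix.of fun a b => (FreeAlgebra.ι k (f i I a b) : c.Quotient)

/-- The smallest congruence of the free algebra modulo which the relations of `ℒ_m` hold. -/
def LCon (R : RFamily k d) (m : ℕ) : RingCon (FreeAlgebra k (LGen d m)) :=
  sInf {c | LRelations R (genMat c LGen.L) (genMat c LGen.Lp) (genMat c LGen.Lm)}

/-- The smallest congruence of the free algebra modulo which the relations of `ℱ_{0,m}` hold. -/
def FCon (R : RFamily k d) (m : ℕ) : RingCon (FreeAlgebra k (FGen d m)) :=
  sInf {c | FRelations R (genMat c FGen.M) (genMat c FGen.N) (genMat c FGen.Np)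
    (genMat c FGen.Nm)}

/-- The algebra `ℒ_m`. -/
abbrev LAlg (R : RFamily k d) (m : ℕ) := (LCon R m).Quotient

/-- The algebra `ℱ_{0,m}`. -/
abbrev FAlg (R : RFamily k d) (m : ℕ) := (FCon R m).Quotient

/-- The matrix generators `L_i` of `ℒ_m`. -/
def matL (R : RFamily k d) (m : ℕ) (i : Fin m) : Mono d (LAlg R m) :=
  genMat (LCon R m) LGen.L i

/-- The upper triangular Gauss components `L_+(i)` in `ℒ_m`. -/
def matLp (R : RFamily k d) (m : ℕ) (i : Fin m) : Mono d (LAlg R m) :=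
  genMat (LCon R m) LGen.Lp i

/-- The lower triangular Gauss components `L_-(i)` in `ℒ_m`. -/
def matLm (R : RFamily k d) (m : ℕ) (i : Fin m) : Mono d (LAlg R m) :=
  genMat (LCon R m) LGen.Lm i

/-- `K_i = L_-(1) ⋯ L_-(i-1)` in `ℒ_m`. -/
def matK (R : RFamily k d) (m : ℕ) (r : Fin (m + 1)) : Mono d (LAlg R m) :=
  gauge (matLm R m) r

/-- The monodromies `M_i` in `ℱ_{0,m}`. -/
def matM (R : RFamily k d) (m : ℕ) (i : Fin m) : Mono d (FAlg R m) :=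
  genMat (FCon R m) FGen.M i

/-- The subalgebra of `ℱ_{0,m}` generated by the matrix elements of the monodromies `M_i`. -/
def monodromySubalgebra (R : RFamily k d) (m : ℕ) : Subalgebra k (FAlg R m) :=
  gaussAdjoin k R {x | ∃ i I a b, x = matM R m i I a b}

/-- The `L`-operator `L_i(z) = L_+(i) + z L_-(i)` of the XXZ chain. -/
def xxzL (R : RFamily k d) (m : ℕ) (i : Fin m) (z : k) : Mono d (LAlg R m) :=
  fun I => matLp R m i I + z • matLm R m i I

/-- The spectral dependent monodromy `M_i(z) = M_i + z 1`. -/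
def spectralM (R : RFamily k d) (m : ℕ) (i : Fin m) (z : k) : Mono d (FAlg R m) :=
  fun I => matM R m i I + z • (1 : Matrix (Fin (d I)) (Fin (d I)) (FAlg R m))

end ChernSimons

end

/-!
The isomorphism sends `L_i` to the dressed monodromy `N_i = K_i⁻¹ M_i K_i`, and its inverse sends
`M_i` to `K_i L_i K_i⁻¹`. Both are well defined once the relations of the `M_i` and those of the
`L_i` imply each other, and this is shown by decoupling one site at a time.

Suppose the first `r` monodromies of a family already commute with all the others, while the later
ones still satisfy the cross exchange relations (`PartlyDressed`). Let `X_-` be the lower Gauss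
component of the monodromy `X` at site `r`. From `X = X_+ X_-⁻¹` and the exchange relations of
`X_±` one gets `R_+ X¹ R_+⁻¹ X_-² = X_-² X¹` (`gauss_conj`). Hence the cross exchange relation of
`X` with a later `Y` says exactly that `X` commutes with `X_-⁻¹ Y X_-`
(`crossExchange_gauss_iff`). Then `X_-` commutes with `X_-⁻¹ Y X_-` as well, and because `X_-`
exchanges with itself through both `R_+` and `R_-`, conjugation by `X_-` neither creates nor
destroys the self exchange relation and the cross exchange relations of the later sites
(`selfExchange_conj_iff`, `crossExchange_conj_iff`). So one step is an equivalence
(`partlyDressed_iff_succ`). Going up from `r = 0` to `r = m` derives the relations of `ℒ_m` in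
`ℱ_{0,m}` (`FRelations.lRelations`); in particular every `N_i` satisfies the self exchange relation,
which is what makes its Gauss components available at the next step. Going down derives the
relations of `ℱ_{0,m}` in `ℒ_m` (`LRelations.fRelations`).

The defining conditions, including the implications among them, pass to jointly injective
families of homomorphisms. Therefore they hold modulo the intersection of all admissible
congruences, and the quotients have the expected universal properties (`exists_lAlg_hom`,
`exists_fAlg_hom`). Finally the monodromies generate all of `ℱ_{0,m}` under the formation of Gauss
components (`monodromySubalgebra_eq_top`), because triangular matrices with invertible diagonal
entries are invertible over the subalgebra their entries and inverse diagonal entries generate.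
-/

namespace ChernSimons

/-! ### Exchange relations in a ring -/

section RingIdentities

variable {G : Type*} [Ring G]

theorem exchange_inv {R R' K₁ K₂ : G} (hR : R * R' = 1) (hR' : R' * R = 1)
    (hK : R * K₁ * K₂ = K₂ * K₁ * R) : R' * K₂ * K₁ = K₁ * K₂ * R' := by
  calc R' * K₂ * K₁ = R' * (K₂ * K₁ * R) * R' := by simp only [mul_assoc, hR, mul_one]
    _ = (R' * R) * K₁ * K₂ * R' := by rw [← hK]; noncomm_ring
    _ = K₁ * K₂ * R' := by rw [hR', one_mul]

/-- The left side `R X¹ R⁻¹ X²` of an exchange relation, for `X = K Y K⁻¹` with `Y` commuting with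
`K`, is the conjugate by `K² K¹` of the same expression in `Y`. -/
theorem conj_left_mul {R R' K₁ K₂ X₁ X₂ Y₁ Y₂ : G} (hR : R * R' = 1) (hR' : R' * R = 1)
    (hK : R * K₁ * K₂ = K₂ * K₁ * R) (h₁ : K₁ * Y₁ = X₁ * K₁) (h₂ : K₂ * Y₂ = X₂ * K₂)
    (h₁₂ : K₁ * Y₂ = Y₂ * K₁) (h₂₁ : Y₁ * K₂ = K₂ * Y₁) :
    R * X₁ * R' * X₂ * (K₂ * K₁) = K₂ * K₁ * (R * Y₁ * R' * Y₂) := by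
  have hK' := exchange_inv hR hR' hK
  linear_combination (norm := noncomm_ring) - R * X₁ * R' * h₂ * K₁ - R * X₁ * R' * K₂ * h₁₂
    + R * X₁ * hK' * Y₂ - R * h₁ * K₂ * R' * Y₂ + R * K₁ * h₂₁ * R' * Y₂ + hK * Y₁ * R' * Y₂

/-- The right side `X² R X¹ R⁻¹` of an exchange relation, for `X = K Y K⁻¹` with `Y` commuting with
`K`, is the conjugate by `K² K¹` of the same expression in `Y`. -/
theorem conj_right_mul {R R' K₁ K₂ X₁ X₂ Y₁ Y₂ : G} (hR : R * R' = 1) (hR' : R' * R = 1)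
    (hK : R * K₁ * K₂ = K₂ * K₁ * R) (h₁ : K₁ * Y₁ = X₁ * K₁) (h₂ : K₂ * Y₂ = X₂ * K₂)
    (h₁₂ : K₁ * Y₂ = Y₂ * K₁) (h₂₁ : Y₁ * K₂ = K₂ * Y₁) :
    X₂ * R * X₁ * R' * (K₂ * K₁) = K₂ * K₁ * (Y₂ * R * Y₁ * R') := by
  have hK' := exchange_inv hR hR' hK
  linear_combination (norm := noncomm_ring) X₂ * R * X₁ * hK' - X₂ * R * h₁ * K₂ * R'
    + X₂ * R * K₁ * h₂₁ * R' + X₂ * hK * Y₁ * R' - h₂ * K₁ * R * Y₁ * R'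
    - K₂ * h₁₂ * R * Y₁ * R'

/-- Two different `R`-matrices are allowed on the two sides: `R_-` and `R_+` give the self exchange
relation, `R_+` twice gives the cross exchange relation. -/
theorem conj_exchange_iff {R R' S S' K₁ K₂ X₁ X₂ Y₁ Y₂ : G} (hR : R * R' = 1) (hR' : R' * R = 1)
    (hS : S * S' = 1) (hS' : S' * S = 1) (hK₁ : IsUnit K₁) (hK₂ : IsUnit K₂)
    (hRK : R * K₁ * K₂ = K₂ * K₁ * R) (hSK : S * K₁ * K₂ = K₂ * K₁ * S)
    (h₁ : K₁ * Y₁ = X₁ * K₁) (h₂ : K₂ * Y₂ = X₂ * K₂)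
    (h₁₂ : K₁ * Y₂ = Y₂ * K₁) (h₂₁ : Y₁ * K₂ = K₂ * Y₁) :
    R * X₁ * R' * X₂ = X₂ * S * X₁ * S' ↔ R * Y₁ * R' * Y₂ = Y₂ * S * Y₁ * S' := by
  have hu := hK₂.mul hK₁
  rw [← hu.mul_left_inj, conj_left_mul hR hR' hRK h₁ h₂ h₁₂ h₂₁,
    conj_right_mul hS hS' hSK h₁ h₂ h₁₂ h₂₁, hu.mul_right_inj]

/-- The relation that drives the decoupling. It holds for `X = P K⁻¹` because both `P¹` and `K¹`
exchange with `K²` through the same matrix `R`. -/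
theorem gauss_conj {R R' X₁ P₁ K₁ K₂ : G} (hR : R * R' = 1) (hR' : R' * R = 1)
    (hK₁ : IsUnit K₁) (hP : X₁ * K₁ = P₁) (hRK : R * K₁ * K₂ = K₂ * K₁ * R)
    (hRP : R * P₁ * K₂ = K₂ * P₁ * R) : R * X₁ * R' * K₂ = K₂ * X₁ := by
  have hK' := exchange_inv hR hR' hRK
  rw [← hK₁.mul_left_inj]
  subst hP
  linear_combination (norm := noncomm_ring) R * X₁ * hK' + hRP * R' + K₂ * X₁ * K₁ * hR

theorem gauss_exchange_iff {R R' X₁ P₁ K₁ K₂ X₂ Y₂ : G} (hR : R * R' = 1) (hR' : R' * R = 1)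
    (hK₁ : IsUnit K₁) (hK₂ : IsUnit K₂) (hP : X₁ * K₁ = P₁)
    (hRK : R * K₁ * K₂ = K₂ * K₁ * R) (hRP : R * P₁ * K₂ = K₂ * P₁ * R)
    (h₂ : K₂ * Y₂ = X₂ * K₂) :
    R * X₁ * R' * X₂ = X₂ * R * X₁ * R' ↔ X₁ * Y₂ = Y₂ * X₁ := by
  have h := gauss_conj hR hR' hK₁ hP hRK hRP
  have e₁ : R * X₁ * R' * X₂ * K₂ = K₂ * (X₁ * Y₂) := by
    linear_combination (norm := noncomm_ring) - R * X₁ * R' * h₂ + h * Y₂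
  have e₂ : X₂ * R * X₁ * R' * K₂ = K₂ * (Y₂ * X₁) := by
    linear_combination (norm := noncomm_ring) X₂ * h - h₂ * X₁
  rw [← hK₂.mul_left_inj, e₁, e₂, hK₂.mul_right_inj]

end RingIdentities

/-! ### Invertibility of triangular matrices -/

section Triangular

variable {A : Type*} [Ring A]

theorem isNilpotent_of_strictly_lower {n : ℕ} (T : Matrix (Fin n) (Fin n) A)
    (hT : ∀ a b, a ≤ b → T a b = 0) : IsNilpotent T := by
  have key : ∀ p : ℕ, ∀ a b : Fin n, (a : ℕ) < b + p → (T ^ p) a b = 0 := by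
    -- each factor moves the support one further diagonal down
    intro p
    induction p with
    | zero => intro a b h; rw [pow_zero, Matrix.one_apply_ne (by rintro rfl; omega)]
    | succ p ih =>
      intro a b h
      rw [pow_succ, Matrix.mul_apply]
      refine Finset.sum_eq_zero fun c _ => ?_
      by_cases hc : c ≤ b
      · rw [hT c b hc, mul_zero]
      · rw [ih a c (by rw [not_le, Fin.lt_def] at hc; omega), zero_mul]
  exact ⟨n, Matrix.ext fun a b => key n a b (by omega)⟩

/-- The inverse of the diagonal times the matrix differs from `1` by a strictly lower triangular,
hence nilpotent, matrix; no commutativity of the entries is needed. -/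
theorem isUnit_of_lower {n : ℕ} (T : Matrix (Fin n) (Fin n) A)
    (hT : ∀ a b, a < b → T a b = 0) (hd : ∀ a, IsUnit (T a a)) : IsUnit T := by
  choose u hu using hd
  have hD : IsUnit (Matrix.diagonal fun a => (u a : A)) :=
    ⟨⟨Matrix.diagonal fun a => (u a : A), Matrix.diagonal fun a => ((u a)⁻¹ : Aˣ).val,
      by rw [Matrix.diagonal_mul_diagonal]; simp, by rw [Matrix.diagonal_mul_diagonal]; simp⟩, rfl⟩
  have hN : IsNilpotent ((Matrix.diagonal fun a => ((u a)⁻¹ : Aˣ).val) * T - 1) := by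
    refine isNilpotent_of_strictly_lower _ fun a b hab => ?_
    rw [Matrix.sub_apply, Matrix.diagonal_mul]
    obtain rfl | h := hab.eq_or_lt
    · rw [← hu, Units.inv_mul, Matrix.one_apply_eq, sub_self]
    · rw [hT a b h, Matrix.one_apply_ne h.ne, mul_zero, sub_zero]
  have := hD.mul hN.isUnit_add_one
  rwa [sub_add_cancel, ← mul_assoc, Matrix.diagonal_mul_diagonal,
    show (fun a => (u a : A) * ((u a)⁻¹ : Aˣ).val) = fun _ => 1 from by ext; simp,
    Matrix.diagonal_one, one_mul] at this

end Triangular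

/-! ### Exchange relations under conjugation by a lower Gauss component -/

section Legs

variable {k : Type*} [CommRing k] {𝔍 : Type*} {d : 𝔍 → ℕ} {A : Type*} [Ring A] [Algebra k A]

theorem leg₁_apply (X : Mono d A) (I J : 𝔍) (p q : Fin (d I) × Fin (d J)) :
    leg₁ X I J p q = if p.2 = q.2 then X I p.1 q.1 else 0 := by
  simp [leg₁, Matrix.kroneckerMap_apply, Matrix.one_apply]

theorem leg₂_apply (X : Mono d A) (I J : 𝔍) (p q : Fin (d I) × Fin (d J)) :
    leg₂ X I J p q = if p.1 = q.1 then X J p.2 q.2 else 0 := by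
  simp [leg₂, Matrix.kroneckerMap_apply, Matrix.one_apply]

theorem leg₁_mul (X Y : Mono d A) (I J : 𝔍) : leg₁ (X * Y) I J = leg₁ X I J * leg₁ Y I J := by
  ext p q
  simp [leg₁_apply, Matrix.mul_apply, Fintype.sum_prod_type]

theorem leg₂_mul (X Y : Mono d A) (I J : 𝔍) : leg₂ (X * Y) I J = leg₂ X I J * leg₂ Y I J := by
  ext p q
  simp [leg₂_apply, Matrix.mul_apply, Fintype.sum_prod_type]

theorem leg₁_one (I J : 𝔍) : leg₁ (1 : Mono d A) I J = 1 := Matrix.one_kronecker_one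

theorem leg₂_one (I J : 𝔍) : leg₂ (1 : Mono d A) I J = 1 := Matrix.one_kronecker_one

theorem isUnit_leg₁ {X : Mono d A} (h : IsUnit X) (I J : 𝔍) : IsUnit (leg₁ X I J) := by
  obtain ⟨⟨X, Y, h, h'⟩, rfl⟩ := h
  exact ⟨⟨leg₁ X I J, leg₁ Y I J, by rw [← leg₁_mul, h, leg₁_one],
    by rw [← leg₁_mul, h', leg₁_one]⟩, rfl⟩

theorem isUnit_leg₂ {X : Mono d A} (h : IsUnit X) (I J : 𝔍) : IsUnit (leg₂ X I J) := by
  obtain ⟨⟨X, Y, h, h'⟩, rfl⟩ := h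
  exact ⟨⟨leg₂ X I J, leg₂ Y I J, by rw [← leg₂_mul, h, leg₂_one],
    by rw [← leg₂_mul, h', leg₂_one]⟩, rfl⟩

/-- Two monodromies commute if `X¹ Y² = Y² X¹` for all pairs of representations. -/
def LegsCommute (X Y : Mono d A) : Prop :=
  ∀ I J : 𝔍, leg₁ X I J * leg₂ Y I J = leg₂ Y I J * leg₁ X I J

theorem legsCommute_iff {X Y : Mono d A} :
    LegsCommute X Y ↔ ∀ I a b J c e, Commute (X I a b) (Y J c e) := by
  have h₁ : ∀ I J p q, (leg₁ X I J * leg₂ Y I J) p q = X I p.1 q.1 * Y J p.2 q.2 := by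
    intro I J p q
    simp [leg₁_apply, leg₂_apply, Matrix.mul_apply, Fintype.sum_prod_type]
  have h₂ : ∀ I J p q, (leg₂ Y I J * leg₁ X I J) p q = Y J p.2 q.2 * X I p.1 q.1 := by
    intro I J p q
    simp [leg₁_apply, leg₂_apply, Matrix.mul_apply, Fintype.sum_prod_type]
  constructor
  · intro h I a b J c e
    have := congrFun (congrFun (h I J) (a, c)) (b, e)
    rwa [h₁, h₂] at this
  · intro h I J
    ext p q
    rw [h₁, h₂]
    exact h _ _ _ _ _ _

theorem LegsCommute.symm {X Y : Mono d A} (h : LegsCommute X Y) : LegsCommute Y X :=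
  legsCommute_iff.2 fun I a b J c e => (legsCommute_iff.1 h J c e I a b).symm

/-- Conjugation by a monodromy commuting with `X` preserves commutation with `X`. -/
theorem LegsCommute.conj {X K Y Z : Mono d A} (hK : IsUnit K) (hXK : LegsCommute X K)
    (hYZ : K * Z = Y * K) : LegsCommute X Y ↔ LegsCommute X Z := by
  refine forall_congr' fun I => forall_congr' fun J => ?_
  have hu := isUnit_leg₂ hK I J
  have e : leg₂ K I J * leg₂ Z I J = leg₂ Y I J * leg₂ K I J := by
    rw [← leg₂_mul, hYZ, leg₂_mul]
  have c := hXK I J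
  rw [← hu.mul_left_inj, mul_assoc, ← e, ← mul_assoc, c, mul_assoc, mul_assoc, c,
    ← mul_assoc (leg₂ Y I J), ← e, mul_assoc, hu.mul_right_inj]

variable {R : RFamily k d}

theorem GaussComponents.isUnit_lower {X Xp Xm : Mono d A} (h : GaussComponents R X Xp Xm) :
    IsUnit Xm :=
  Pi.isUnit_iff.2 fun I => isUnit_of_lower _ (fun a b => h.lower I a b) fun a =>
    ⟨⟨_, Xp I a a, h.diag_mp I a, h.diag_pm I a⟩, rfl⟩

theorem GaussComponents.legsCommute_lower {X Xp Xm Y : Mono d A}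
    (h : GaussComponents R X Xp Xm) (hY : LegsCommute Y X) : LegsCommute Y Xm :=
  legsCommute_iff.2 fun I a b J c e =>
    (h.commute_of_commute _ (legsCommute_iff.1 hY I a b) J c e).2

theorem reindex_leg₁ (X : Mono d A) (I J : 𝔍) :
    Matrix.reindexAlgEquiv ℕ A (Equiv.prodComm (Fin (d J)) (Fin (d I))) (leg₁ X J I)
      = leg₂ X I J := by
  ext p q
  simp [leg₁_apply, leg₂_apply]

theorem reindex_leg₂ (X : Mono d A) (I J : 𝔍) :
    Matrix.reindexAlgEquiv ℕ A (Equiv.prodComm (Fin (d J)) (Fin (d I))) (leg₂ X J I)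
      = leg₁ X I J := by
  ext p q
  simp [leg₁_apply, leg₂_apply]

theorem reindex_rminus (I J : 𝔍) :
    Matrix.reindexAlgEquiv ℕ A (Equiv.prodComm (Fin (d J)) (Fin (d I))) (Rminus R A J I).val
      = (Rplus R A I J)⁻¹.val := by
  ext p q
  simp [Rminus]

/-- The exchange relation for `X_-` with `R_-` is equivalent to the one with `R_+`: conjugation
with the permutation exchanges both the legs and `R_-` with `R_+⁻¹`. -/
theorem GaussComponents.exch_mm_plus {X Xp Xm : Mono d A} (h : GaussComponents R X Xp Xm)
    (I J : 𝔍) : (Rplus R A I J).val * leg₁ Xm I J * leg₂ Xm I J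
      = leg₂ Xm I J * leg₁ Xm I J * (Rplus R A I J).val := by
  have e := congrArg
    (Matrix.reindexAlgEquiv ℕ A (Equiv.prodComm (Fin (d J)) (Fin (d I)))) (h.exch_mm J I)
  simp only [map_mul, reindex_leg₁, reindex_leg₂, reindex_rminus] at e
  rw [mul_assoc, Units.inv_mul_eq_iff_eq_mul] at e
  rw [e]
  simp only [mul_assoc, Units.inv_mul, mul_one]

theorem selfExchange_conj_iff {X Xp K Y Z : Mono d A} (h : GaussComponents R X Xp K)
    (hKZ : LegsCommute K Z) (hYZ : K * Z = Y * K) : SelfExchange R Y ↔ SelfExchange R Z := by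
  refine forall_congr' fun I => forall_congr' fun J => ?_
  exact conj_exchange_iff (Units.mul_inv _) (Units.inv_mul _) (Units.mul_inv _) (Units.inv_mul _)
    (isUnit_leg₁ h.isUnit_lower I J) (isUnit_leg₂ h.isUnit_lower I J)
    (h.exch_mm I J) (h.exch_mm_plus I J)
    (by rw [← leg₁_mul, hYZ, leg₁_mul]) (by rw [← leg₂_mul, hYZ, leg₂_mul])
    (hKZ I J) (hKZ.symm I J)

theorem crossExchange_conj_iff {X Xp K Y Z Y' Z' : Mono d A} (h : GaussComponents R X Xp K)
    (hKZ : LegsCommute K Z) (hKZ' : LegsCommute K Z') (hYZ : K * Z = Y * K)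
    (hYZ' : K * Z' = Y' * K) : CrossExchange R Y Y' ↔ CrossExchange R Z Z' := by
  refine forall_congr' fun I => forall_congr' fun J => ?_
  exact conj_exchange_iff (Units.mul_inv _) (Units.inv_mul _) (Units.mul_inv _) (Units.inv_mul _)
    (isUnit_leg₁ h.isUnit_lower I J) (isUnit_leg₂ h.isUnit_lower I J)
    (h.exch_mm_plus I J) (h.exch_mm_plus I J)
    (by rw [← leg₁_mul, hYZ, leg₁_mul]) (by rw [← leg₂_mul, hYZ', leg₂_mul])
    (hKZ' I J) (hKZ.symm I J)

/-- Conjugating the second factor by `X_-` turns the cross exchange relation with `X` into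
commutation with `X`, because `R_+ X¹ R_+⁻¹ X_-² = X_-² X¹`. -/
theorem crossExchange_gauss_iff {X Xp Xm Y Z : Mono d A} (h : GaussComponents R X Xp Xm)
    (hYZ : Xm * Z = Y * Xm) : CrossExchange R X Y ↔ LegsCommute X Z := by
  refine forall_congr' fun I => forall_congr' fun J => ?_
  exact gauss_exchange_iff (Units.mul_inv _) (Units.inv_mul _)
    (isUnit_leg₁ h.isUnit_lower I J) (isUnit_leg₂ h.isUnit_lower I J)
    (by rw [← leg₁_mul, show X * Xm = Xp from funext h.factor])
    (h.exch_mm_plus I J) (h.exch_pm I J) (by rw [← leg₂_mul, hYZ, leg₂_mul])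

end Legs

/-! ### Decoupling the sites one after the other -/

section Dressing

variable {k : Type*} [CommRing k] {𝔍 : Type*} {d : 𝔍 → ℕ} {A : Type*} [Ring A] [Algebra k A]
  {R : RFamily k d} {m : ℕ}

/-- The exchange relations of a family of monodromies of which the first `r` have been decoupled:
the monodromies `Z_i`, `i < r`, commute with all others, while the remaining ones still obey the
cross exchange relation among each other. For `r = 0` these are the relations of the `M_i`, for
`r = m` those of the `L_i`. -/
structure PartlyDressed (R : RFamily k d) (r : ℕ) (Z : Fin m → Mono d A) : Prop where
  self : ∀ j, SelfExchange R (Z j)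
  comm : ∀ i j, i < j → i.val < r → LegsCommute (Z i) (Z j)
  cross : ∀ i j, i < j → r ≤ i.val → CrossExchange R (Z i) (Z j)

/-- Conjugating all later monodromies by the lower Gauss component of `Z_r` decouples `Z_r`. -/
theorem partlyDressed_iff_succ (r : Fin m) {Z Z' : Fin m → Mono d A} {Xp Xm : Mono d A}
    (h : GaussComponents R (Z r) Xp Xm) (hle : ∀ j ≤ r, Z' j = Z j)
    (hlt : ∀ j, r < j → Xm * Z' j = Z j * Xm) :
    PartlyDressed R r Z ↔ PartlyDressed R (r + 1) Z' := by
  have hr := hle r le_rfl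
  constructor
  · intro H
    have hc : ∀ j, r < j → LegsCommute (Z r) (Z' j) := fun j hj =>
      (crossExchange_gauss_iff h (hlt j hj)).1 (H.cross r j hj le_rfl)
    have hK : ∀ j, r < j → LegsCommute Xm (Z' j) := fun j hj =>
      (h.legsCommute_lower (hc j hj).symm).symm
    refine ⟨fun j => ?_, fun i j hij hi => ?_, fun i j hij hi => ?_⟩
    · obtain hj | hj := le_or_gt j r
      · rw [hle j hj]; exact H.self j
      · exact (selfExchange_conj_iff h (hK j hj) (hlt j hj)).1 (H.self j)
    · obtain hj | hj := le_or_gt j r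
      · rw [hle j hj, hle i (hij.le.trans hj)]
        exact H.comm i j hij (lt_of_lt_of_le hij hj)
      · obtain rfl | hir := eq_or_ne i r
        · rw [hr]; exact hc j hj
        · have hir' : i < r := lt_of_le_of_ne (Fin.le_def.2 (by omega)) hir
          rw [hle i hir'.le]
          exact (LegsCommute.conj h.isUnit_lower (h.legsCommute_lower (H.comm i r hir' hir'))
            (hlt j hj)).1 (H.comm i j hij hir')
    · have hi' : r < i := Fin.lt_def.2 (by omega)
      exact (crossExchange_conj_iff h (hK i hi') (hK j (hi'.trans hij)) (hlt i hi')
        (hlt j (hi'.trans hij))).1 (H.cross i j hij hi'.le)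
  · intro H
    have hc : ∀ j, r < j → LegsCommute (Z r) (Z' j) := fun j hj =>
      hr ▸ H.comm r j hj (by omega)
    have hK : ∀ j, r < j → LegsCommute Xm (Z' j) := fun j hj =>
      (h.legsCommute_lower (hc j hj).symm).symm
    refine ⟨fun j => ?_, fun i j hij hi => ?_, fun i j hij hi => ?_⟩
    · obtain hj | hj := le_or_gt j r
      · rw [← hle j hj]; exact H.self j
      · exact (selfExchange_conj_iff h (hK j hj) (hlt j hj)).2 (H.self j)
    · have hir : i < r := hi
      obtain hj | hj := le_or_gt j r
      · rw [← hle j hj, ← hle i hir.le]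
        exact H.comm i j hij (by omega)
      · have hir' := H.comm i r hir (by omega)
        have hij' := H.comm i j hij (by omega)
        rw [hle i hir.le] at hir' hij'
        rw [hr] at hir'
        exact (LegsCommute.conj h.isUnit_lower (h.legsCommute_lower hir') (hlt j hj)).2 hij'
    · obtain rfl | hir := eq_or_ne i r
      · exact (crossExchange_gauss_iff h (hlt j hij)).2 (hc j hij)
      · have hi' : r < i := lt_of_le_of_ne (Fin.le_def.2 hi) hir.symm
        exact (crossExchange_conj_iff h (hK i hi') (hK j (hi'.trans hij)) (hlt i hi')
          (hlt j (hi'.trans hij))).2 (H.cross i j hij (by omega))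

theorem gauge_zero (Nm : Fin m → Mono d A) : gauge Nm 0 = 1 := by
  funext I; exact Fin.partialProd_zero _

theorem gauge_succ (Nm : Fin m → Mono d A) (i : Fin m) :
    gauge Nm i.succ = gauge Nm i.castSucc * Nm i := by
  funext I; exact Fin.partialProd_succ _ _

theorem isUnit_gauge {Nm : Fin m → Mono d A} (h : ∀ i, IsUnit (Nm i)) (r : Fin (m + 1)) :
    IsUnit (gauge Nm r) := by
  induction r using Fin.induction with
  | zero => rw [gauge_zero]; exact isUnit_one
  | succ i ih => rw [gauge_succ]; exact ih.mul (h i)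

/-- The monodromy `M_j` conjugated by those of the first `r` lower Gauss components that belong to
sites before `j`. The ordinary inverse is meant: the gauge factor is invertible wherever this is
used. -/
noncomputable def dressing (M Nm : Fin m → Mono d A) (r : Fin (m + 1)) (j : Fin m) : Mono d A :=
  Ring.inverse (gauge Nm (min r j.castSucc)) * M j * gauge Nm (min r j.castSucc)

/-- Passing from `r` to `r + 1` conjugates exactly the sites after `r`, by the factor `N_-(r)` that
`K_{r+1}` has in excess of `K_r`. -/
theorem dressing_step {M Nm : Fin m → Mono d A} {Xp : Mono d A} {r : Fin m}
    (hK : IsUnit (gauge Nm r.castSucc))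
    (h : GaussComponents R (dressing M Nm r.castSucc r) Xp (Nm r)) :
    PartlyDressed R r (dressing M Nm r.castSucc) ↔
      PartlyDressed R (r + 1) (dressing M Nm r.succ) := by
  refine partlyDressed_iff_succ r h (fun j hj => ?_) fun j hj => ?_
  · have h₁ : j.castSucc ≤ r.castSucc := hj
    rw [dressing, dressing, min_eq_right h₁, min_eq_right (h₁.trans (Fin.castSucc_lt_succ).le)]
  · have h₁ : r.succ ≤ j.castSucc := Fin.succ_le_castSucc_iff.2 hj
    rw [dressing, dressing, min_eq_left h₁, min_eq_left ((Fin.castSucc_lt_succ).le.trans h₁),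
      gauge_succ]
    obtain ⟨K, hK⟩ := hK
    obtain ⟨X, hX⟩ := h.isUnit_lower
    rw [← hK, ← hX, ← Units.val_mul, Ring.inverse_unit, Ring.inverse_unit, mul_inv_rev]
    simp only [Units.val_mul, mul_assoc, Units.mul_inv_cancel_left]

theorem dressing_eq_of_dressed {M Nm : Fin m → Mono d A} {N : Mono d A} {j : Fin m}
    {r : Fin (m + 1)} (hr : j.castSucc ≤ r) (hK : IsUnit (gauge Nm j.castSucc))
    (h : gauge Nm j.castSucc * N = M j * gauge Nm j.castSucc) : dressing M Nm r j = N := by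
  rw [dressing, min_eq_right hr, mul_assoc, ← h, Ring.inverse_mul_cancel_left _ _ hK]

theorem dressing_zero (M Nm : Fin m → Mono d A) : dressing M Nm 0 = M := by
  funext j
  rw [dressing, min_eq_left (Fin.zero_le _), gauge_zero, Ring.inverse_one, one_mul, mul_one]

/-- Commuting monodromies `L_i` with Gauss components satisfy, together with the monodromies
`M_i = K_i L_i K_i⁻¹`, the relations of `ℱ_{0,m}`. -/
theorem LRelations.fRelations {L Lp Lm M : Fin m → Mono d A} (h : LRelations R L Lp Lm)
    (hM : ∀ i, gauge Lm i.castSucc * L i = M i * gauge Lm i.castSucc) :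
    FRelations R M L Lp Lm := by
  have hu := isUnit_gauge fun i => (h.gauss i).isUnit_lower
  have key : ∀ r : Fin (m + 1), PartlyDressed R r (dressing M Lm r) := by
    intro r
    induction r using Fin.reverseInduction with
    | last =>
      have e : dressing M Lm (Fin.last m) = L :=
        funext fun j => dressing_eq_of_dressed (Fin.le_last _) (hu _) (hM j)
      rw [e]
      exact ⟨h.self, fun i j hij _ => h.comm i j hij.ne,
        fun i j _ hi => absurd i.isLt (not_lt.2 hi)⟩
    | cast i ih =>
      refine (dressing_step (Xp := Lp i) (hu _) ?_).2 ih
      rw [dressing_eq_of_dressed le_rfl (hu _) (hM i)]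
      exact h.gauss i
  have h₀ := key 0
  rw [dressing_zero] at h₀
  exact ⟨h₀.self, fun i j hij => h₀.cross i j hij (Nat.zero_le _),
    fun i I => congrFun (hM i) I, fun i _ => h.gauss i⟩

/-- The relations of `ℱ_{0,m}` force the dressed monodromies `N_i` to satisfy those of `ℒ_m`: they
obey the self exchange relation, so `N_±(i)` are Gauss components, and they commute. The
invertibility of the gauge factors has to be obtained along the way, since it rests on the Gauss
components of the earlier sites. -/
theorem FRelations.lRelations {M N Np Nm : Fin m → Mono d A} (h : FRelations R M N Np Nm) :
    LRelations R N Np Nm := by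
  have hd : ∀ i, gauge Nm i.castSucc * N i = M i * gauge Nm i.castSucc :=
    fun i => funext (h.dressed i)
  have key : ∀ r : Fin (m + 1), IsUnit (gauge Nm r) ∧ PartlyDressed R r (dressing M Nm r) := by
    intro r
    induction r using Fin.induction with
    | zero =>
      rw [gauge_zero, dressing_zero]
      exact ⟨isUnit_one, h.self, fun i j _ hi => absurd hi (Nat.not_lt_zero _),
        fun i j hij _ => h.cross i j hij⟩
    | succ i ih =>
      -- `N_i` is the monodromy at site `i` after `i` steps, so its self exchange relation is known
      have e := dressing_eq_of_dressed le_rfl ih.1 (hd i)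
      have hg := h.gauss i (e ▸ ih.2.self i)
      rw [gauge_succ]
      exact ⟨ih.1.mul hg.isUnit_lower, (dressing_step ih.1 (e.symm ▸ hg)).1 ih.2⟩
  have e : dressing M Nm (Fin.last m) = N :=
    funext fun j => dressing_eq_of_dressed (Fin.le_last _) (key _).1 (hd j)
  have h₁ := (key (Fin.last m)).2
  rw [e] at h₁
  refine ⟨h₁.self, fun i j hij => ?_, fun i => h.gauss i (h₁.self i)⟩
  obtain hij | hij := lt_or_gt_of_ne hij
  · exact h₁.comm i j hij i.isLt
  · exact (h₁.comm j i hij j.isLt).symm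

end Dressing

/-! ### Transfer of the relations along homomorphisms -/

section Transfer

variable {k : Type*} [CommRing k] {𝔍 : Type*} {d : 𝔍 → ℕ} {A B : Type*} [Ring A] [Algebra k A]
  [Ring B] [Algebra k B] {R : RFamily k d} {m : ℕ}

/-- The monodromy obtained by applying an algebra homomorphism to all matrix elements, as a ring
homomorphism. -/
noncomputable def mapMono (f : A →ₐ[k] B) : Mono d A →+* Mono d B :=
  RingHom.pi fun I => (f.mapMatrix (m := Fin (d I))).toRingHom.comp (Pi.evalRingHom _ I)

theorem mapMono_apply (f : A →ₐ[k] B) (X : Mono d A) (I : 𝔍) (a b : Fin (d I)) :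
    mapMono f X I a b = f (X I a b) := rfl

theorem leg₁_mapMono (f : A →ₐ[k] B) (X : Mono d A) (I J : 𝔍) :
    leg₁ (mapMono f X) I J = f.mapMatrix (leg₁ X I J) := by
  ext p q
  simp [leg₁_apply, mapMono_apply, apply_ite f]

theorem leg₂_mapMono (f : A →ₐ[k] B) (X : Mono d A) (I J : 𝔍) :
    leg₂ (mapMono f X) I J = f.mapMatrix (leg₂ X I J) := by
  ext p q
  simp [leg₂_apply, mapMono_apply, apply_ite f]

theorem rplus_map (f : A →ₐ[k] B) (I J : 𝔍) :
    (Rplus R B I J).val = f.mapMatrix (Rplus R A I J).val := by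
  ext p q
  simp [Rplus]

theorem rplus_inv_map (f : A →ₐ[k] B) (I J : 𝔍) :
    (Rplus R B I J)⁻¹.val = f.mapMatrix (Rplus R A I J)⁻¹.val := by
  rw [Rplus, Rplus, ← map_inv, ← map_inv]
  ext p q
  simp

theorem rminus_map (f : A →ₐ[k] B) (I J : 𝔍) :
    (Rminus R B I J).val = f.mapMatrix (Rminus R A I J).val := by
  have h := rplus_inv_map (R := R) f J I
  ext p q
  simpa [Rminus] using congrFun (congrFun h p.swap) q.swap

theorem rminus_inv_map (f : A →ₐ[k] B) (I J : 𝔍) :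
    (Rminus R B I J)⁻¹.val = f.mapMatrix (Rminus R A I J)⁻¹.val := by
  have h := rplus_map (R := R) f J I
  rw [Rminus, Rminus, ← map_inv, ← map_inv, inv_inv, inv_inv]
  ext p q
  simpa using congrFun (congrFun h p.swap) q.swap

theorem SelfExchange.map {X : Mono d A} (h : SelfExchange R X) (f : A →ₐ[k] B) :
    SelfExchange R (mapMono f X) := by
  intro I J
  simp only [leg₁_mapMono, leg₂_mapMono, rplus_map f, rplus_inv_map f, rminus_map f,
    rminus_inv_map f, ← map_mul]
  exact congrArg _ (h I J)

section Jointly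

variable {ι : Type*} {C : ι → Type*} [∀ i, Ring (C i)] [∀ i, Algebra k (C i)]
  (f : ∀ i, A →ₐ[k] C i)

/-- A family of homomorphisms that separates the elements of `A`. -/
def JointlyInjective : Prop := ∀ x y : A, (∀ i, f i x = f i y) → x = y

variable {f}

theorem JointlyInjective.matrix_ext (hf : JointlyInjective f) {n : Type*} [Fintype n]
    [DecidableEq n] {X Y : Matrix n n A} (h : ∀ i, (f i).mapMatrix X = (f i).mapMatrix Y) :
    X = Y :=
  Matrix.ext fun a b => hf _ _ fun i => congrFun (congrFun (h i) a) b

theorem JointlyInjective.selfExchange (hf : JointlyInjective f) {X : Mono d A}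
    (h : ∀ i, SelfExchange R (mapMono (f i) X)) : SelfExchange R X := by
  intro I J
  refine hf.matrix_ext fun i => ?_
  have := h i I J
  simpa only [leg₁_mapMono, leg₂_mapMono, rplus_map (f i), rplus_inv_map (f i), rminus_map (f i),
    rminus_inv_map (f i), ← map_mul] using this

theorem JointlyInjective.crossExchange (hf : JointlyInjective f) {X Y : Mono d A}
    (h : ∀ i, CrossExchange R (mapMono (f i) X) (mapMono (f i) Y)) : CrossExchange R X Y := by
  intro I J
  refine hf.matrix_ext fun i => ?_
  have := h i I J
  simpa only [leg₁_mapMono, leg₂_mapMono, rplus_map (f i), rplus_inv_map (f i),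
    ← map_mul] using this

theorem JointlyInjective.gaussComponents (hf : JointlyInjective f) {X Xp Xm : Mono d A}
    (h : ∀ i, GaussComponents R (mapMono (f i) X) (mapMono (f i) Xp) (mapMono (f i) Xm)) :
    GaussComponents R X Xp Xm where
  upper I a b hab := hf _ _ fun i => by
    rw [map_zero]; exact (h i).upper I a b hab
  lower I a b hab := hf _ _ fun i => by
    rw [map_zero]; exact (h i).lower I a b hab
  diag_pm I a := hf _ _ fun i => by
    rw [map_mul, map_one]; exact (h i).diag_pm I a
  diag_mp I a := hf _ _ fun i => by
    rw [map_mul, map_one]; exact (h i).diag_mp I a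
  factor I := hf.matrix_ext fun i => by
    rw [map_mul]; exact (h i).factor I
  exch_pp I J := hf.matrix_ext fun i => by
    have := (h i).exch_pp I J
    simpa only [leg₁_mapMono, leg₂_mapMono, rplus_map (f i), ← map_mul] using this
  exch_mm I J := hf.matrix_ext fun i => by
    have := (h i).exch_mm I J
    simpa only [leg₁_mapMono, leg₂_mapMono, rminus_map (f i), ← map_mul] using this
  exch_pm I J := hf.matrix_ext fun i => by
    have := (h i).exch_pm I J
    simpa only [leg₁_mapMono, leg₂_mapMono, rplus_map (f i), ← map_mul] using this
  commute_of_commute x hx I a b := by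
    have key := fun i => (h i).commute_of_commute (f i x) (fun J c e => (hx J c e).map (f i)) I a b
    constructor <;> refine hf _ _ fun i => ?_ <;> rw [map_mul, map_mul]
    · exact (key i).1
    · exact (key i).2

theorem JointlyInjective.lRelations (hf : JointlyInjective f) {L Lp Lm : Fin m → Mono d A}
    (h : ∀ i, LRelations R (fun j => mapMono (f i) (L j)) (fun j => mapMono (f i) (Lp j))
      (fun j => mapMono (f i) (Lm j))) : LRelations R L Lp Lm where
  self j := hf.selfExchange fun i => (h i).self j
  comm j l hjl I J := hf.matrix_ext fun i => by
    have := (h i).comm j l hjl I J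
    simpa only [leg₁_mapMono, leg₂_mapMono, ← map_mul] using this
  gauss j := hf.gaussComponents fun i => (h i).gauss j

theorem gauge_mapMono (g : A →ₐ[k] B) (Nm : Fin m → Mono d A) (r : Fin (m + 1)) :
    gauge (fun j => mapMono g (Nm j)) r = mapMono g (gauge Nm r) := by
  induction r using Fin.induction with
  | zero => rw [gauge_zero, gauge_zero, map_one]
  | succ i ih => rw [gauge_succ, gauge_succ, map_mul, ih]

/-- The conditional axiom on Gauss components is inherited because its premise `SelfExchange` is
preserved by all homomorphisms. -/
theorem JointlyInjective.fRelations (hf : JointlyInjective f) {M N Np Nm : Fin m → Mono d A}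
    (h : ∀ i, FRelations R (fun j => mapMono (f i) (M j)) (fun j => mapMono (f i) (N j))
      (fun j => mapMono (f i) (Np j)) (fun j => mapMono (f i) (Nm j))) :
    FRelations R M N Np Nm where
  self j := hf.selfExchange fun i => (h i).self j
  cross j l hjl := hf.crossExchange fun i => (h i).cross j l hjl
  dressed j I := hf.matrix_ext fun i => by
    have := (h i).dressed j I
    rw [gauge_mapMono] at this
    rw [map_mul, map_mul]
    exact this
  gauss j hj := hf.gaussComponents fun i => (h i).gauss j (hj.map (f i))

end Jointly

end Transfer

/-! ### The universal algebras -/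

section Universal

variable {k : Type*} [CommRing k] {𝔍 : Type*} {d : 𝔍 → ℕ} {R : RFamily k d} {m : ℕ}
  {B : Type*} [Ring B] [Algebra k B] {G : Type*}

/-- The quotient by an intersection of congruences embeds into the product of the quotients. -/
theorem jointlyInjective_sInf (s : Set (RingCon (FreeAlgebra k G))) :
    JointlyInjective fun c : s => RingCon.factorₐ k (sInf_le c.2 : sInf s ≤ c.1) := by
  intro x y h
  obtain ⟨x, rfl⟩ := RingCon.mkₐ_surjective (α := k) _ x
  obtain ⟨y, rfl⟩ := RingCon.mkₐ_surjective (α := k) _ y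
  refine (RingCon.eq _).2 fun c hc => ?_
  exact (RingCon.eq _).1 (h ⟨c, hc⟩)

theorem mapMono_genMat_kerLift (φ : FreeAlgebra k G →ₐ[k] B)
    (f : ∀ (_ : Fin m) (I : 𝔍) (_ _ : Fin (d I)), G) (i : Fin m) :
    mapMono (RingCon.kerLiftₐ φ) (genMat (RingCon.ker φ.toRingHom) f i)
      = fun I => Matrix.of fun a b => φ (FreeAlgebra.ι k (f i I a b)) := rfl

theorem jointlyInjective_kerLift (φ : FreeAlgebra k G →ₐ[k] B) :
    JointlyInjective fun _ : Unit => RingCon.kerLiftₐ φ :=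
  fun _ _ h => RingCon.kerLiftₐ_injective φ (h ())

/-- The defining relations hold in `ℒ_m`: they pass to intersections of congruences. -/
theorem lRelations_mat (R : RFamily k d) (m : ℕ) :
    LRelations R (matL R m) (matLp R m) (matLm R m) :=
  (jointlyInjective_sInf _).lRelations fun c => c.2

/-- The defining relations hold in `ℱ_{0,m}`: they pass to intersections of congruences. -/
theorem fRelations_mat (R : RFamily k d) (m : ℕ) :
    FRelations R (matM R m) (genMat (FCon R m) FGen.N) (genMat (FCon R m) FGen.Np)
      (genMat (FCon R m) FGen.Nm) :=
  (jointlyInjective_sInf _).fRelations fun c => c.2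

/-- The universal property of `ℒ_m`. -/
theorem exists_lAlg_hom {L Lp Lm : Fin m → Mono d B} (h : LRelations R L Lp Lm) :
    ∃ f : LAlg R m →ₐ[k] B, ∀ i, mapMono f (matL R m i) = L i ∧
      mapMono f (matLp R m i) = Lp i ∧ mapMono f (matLm R m i) = Lm i := by
  let φ : FreeAlgebra k (LGen d m) →ₐ[k] B := FreeAlgebra.lift k fun x => match x with
    | .L i I a b => L i I a b
    | .Lp i I a b => Lp i I a b
    | .Lm i I a b => Lm i I a b
  have e₁ : ∀ i, mapMono (RingCon.kerLiftₐ φ) (genMat (RingCon.ker φ.toRingHom) LGen.L i) = L i :=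
    fun i => by rw [mapMono_genMat_kerLift]; ext; simp [φ]
  have e₂ : ∀ i, mapMono (RingCon.kerLiftₐ φ) (genMat (RingCon.ker φ.toRingHom) LGen.Lp i) = Lp i :=
    fun i => by rw [mapMono_genMat_kerLift]; ext; simp [φ]
  have e₃ : ∀ i, mapMono (RingCon.kerLiftₐ φ) (genMat (RingCon.ker φ.toRingHom) LGen.Lm i) = Lm i :=
    fun i => by rw [mapMono_genMat_kerLift]; ext; simp [φ]
  have hc : LCon R m ≤ RingCon.ker φ.toRingHom := sInf_le <|
    (jointlyInjective_kerLift φ).lRelations fun _ => by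
      simp only [e₁, e₂, e₃]; exact h
  refine ⟨(RingCon.kerLiftₐ φ).comp (RingCon.factorₐ k hc), fun i => ⟨?_, ?_, ?_⟩⟩
  exacts [e₁ i, e₂ i, e₃ i]

/-- The universal property of `ℱ_{0,m}`. -/
theorem exists_fAlg_hom {M N Np Nm : Fin m → Mono d B} (h : FRelations R M N Np Nm) :
    ∃ f : FAlg R m →ₐ[k] B, ∀ i, mapMono f (matM R m i) = M i ∧
      mapMono f (genMat (FCon R m) FGen.N i) = N i ∧
      mapMono f (genMat (FCon R m) FGen.Np i) = Np i ∧
      mapMono f (genMat (FCon R m) FGen.Nm i) = Nm i := by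
  let φ : FreeAlgebra k (FGen d m) →ₐ[k] B := FreeAlgebra.lift k fun x => match x with
    | .M i I a b => M i I a b
    | .N i I a b => N i I a b
    | .Np i I a b => Np i I a b
    | .Nm i I a b => Nm i I a b
  have e₀ : ∀ i, mapMono (RingCon.kerLiftₐ φ) (genMat (RingCon.ker φ.toRingHom) FGen.M i) = M i :=
    fun i => by rw [mapMono_genMat_kerLift]; ext; simp [φ]
  have e₁ : ∀ i, mapMono (RingCon.kerLiftₐ φ) (genMat (RingCon.ker φ.toRingHom) FGen.N i) = N i :=
    fun i => by rw [mapMono_genMat_kerLift]; ext; simp [φ]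
  have e₂ : ∀ i, mapMono (RingCon.kerLiftₐ φ) (genMat (RingCon.ker φ.toRingHom) FGen.Np i) = Np i :=
    fun i => by rw [mapMono_genMat_kerLift]; ext; simp [φ]
  have e₃ : ∀ i, mapMono (RingCon.kerLiftₐ φ) (genMat (RingCon.ker φ.toRingHom) FGen.Nm i) = Nm i :=
    fun i => by rw [mapMono_genMat_kerLift]; ext; simp [φ]
  have hc : FCon R m ≤ RingCon.ker φ.toRingHom := sInf_le <|
    (jointlyInjective_kerLift φ).fRelations fun _ => by
      simp only [e₀, e₁, e₂, e₃]; exact h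
  refine ⟨(RingCon.kerLiftₐ φ).comp (RingCon.factorₐ k hc), fun i => ⟨?_, ?_, ?_, ?_⟩⟩
  exacts [e₀ i, e₁ i, e₂ i, e₃ i]

theorem lAlg_hom_ext {f g : LAlg R m →ₐ[k] B} (h₁ : ∀ i, mapMono f (matL R m i) =
    mapMono g (matL R m i)) (h₂ : ∀ i, mapMono f (matLp R m i) = mapMono g (matLp R m i))
    (h₃ : ∀ i, mapMono f (matLm R m i) = mapMono g (matLm R m i)) : f = g := by
  refine RingCon.Quotient.hom_extₐ (FreeAlgebra.hom_ext (funext fun x => ?_))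
  cases x with
  | L i I a b => exact congrFun (congrFun (congrFun (h₁ i) I) a) b
  | Lp i I a b => exact congrFun (congrFun (congrFun (h₂ i) I) a) b
  | Lm i I a b => exact congrFun (congrFun (congrFun (h₃ i) I) a) b

/-- A subalgebra of `ℱ_{0,m}` is everything as soon as it contains all generators. -/
theorem fAlg_subalgebra_eq_top {S : Subalgebra k (FAlg R m)}
    (hM : ∀ i I a b, matM R m i I a b ∈ S)
    (hN : ∀ i I a b, genMat (FCon R m) FGen.N i I a b ∈ S)
    (hNp : ∀ i I a b, genMat (FCon R m) FGen.Np i I a b ∈ S)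
    (hNm : ∀ i I a b, genMat (FCon R m) FGen.Nm i I a b ∈ S) : S = ⊤ := by
  have h : (⊤ : Subalgebra k (FreeAlgebra k (FGen d m))) ≤ S.comap (RingCon.mkₐ k _) := by
    rw [← FreeAlgebra.adjoin_range_ι, Algebra.adjoin_le_iff]
    rintro _ ⟨x, rfl⟩
    cases x with
    | M i I a b => exact hM i I a b
    | N i I a b => exact hN i I a b
    | Np i I a b => exact hNp i I a b
    | Nm i I a b => exact hNm i I a b
  refine eq_top_iff.2 fun x _ => ?_
  obtain ⟨x, rfl⟩ := RingCon.mkₐ_surjective (α := k) _ x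
  exact h (x := x) trivial

end Universal

/-! ### Generation by the monodromies, and the isomorphism -/

section Generation

variable {k : Type*} [CommRing k] {𝔍 : Type*} {d : 𝔍 → ℕ} {A : Type*} [Ring A] [Algebra k A]
  {R : RFamily k d} {m : ℕ}

/-- If the Gauss components have entries in a subalgebra `S`, then the lower one is invertible over
`S`: the inverses of its diagonal entries are entries of the upper one. -/
theorem GaussComponents.exists_unit_subalgebra {X Xp Xm : Mono d A}
    (h : GaussComponents R X Xp Xm) {S : Subalgebra k A}
    (hS : ∀ I a b, Xp I a b ∈ S ∧ Xm I a b ∈ S) :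
    ∃ V : (Mono d S)ˣ, mapMono S.val V.val = Xm := by
  have hu : IsUnit (fun I => Matrix.of fun a b => ⟨Xm I a b, (hS I a b).2⟩ : Mono d S) :=
    Pi.isUnit_iff.2 fun I => isUnit_of_lower _ (fun a b hab => Subtype.ext (h.lower I a b hab))
      fun a => ⟨⟨_, ⟨Xp I a a, (hS I a a).1⟩, Subtype.ext (h.diag_mp I a),
        Subtype.ext (h.diag_pm I a)⟩, rfl⟩
  obtain ⟨V, hV⟩ := hu
  exact ⟨V, by rw [hV]; rfl⟩

/-- The monodromies generate `ℱ_{0,m}` under the formation of Gauss components: `N_i` is obtained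
from `M_i` and the Gauss components of `N_1, …, N_{i-1}`. -/
theorem monodromySubalgebra_eq_top (R : RFamily k d) (m : ℕ) : monodromySubalgebra R m = ⊤ := by
  rw [monodromySubalgebra, gaussAdjoin, sInf_eq_top]
  rintro S ⟨hM, hS⟩
  have h := fRelations_mat R m
  have hL := h.lRelations
  have hM' : ∀ i I a b, matM R m i I a b ∈ S := fun i I a b => hM ⟨i, I, a, b, rfl⟩
  have hN : ∀ i : Fin m, ∀ U : (Mono d S)ˣ,
      mapMono S.val U.val = gauge (genMat (FCon R m) FGen.Nm) i.castSucc →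
      ∀ I a b, genMat (FCon R m) FGen.N i I a b ∈ S := by
    intro i U hU I a b
    let M' : Mono d S := fun I => Matrix.of fun a b => ⟨matM R m i I a b, hM' i I a b⟩
    have e : genMat (FCon R m) FGen.N i = mapMono S.val (U⁻¹.val * M' * U.val) := by
      have hd : mapMono S.val U.val * genMat (FCon R m) FGen.N i
          = mapMono S.val M' * mapMono S.val U.val := by
        rw [hU]; exact funext (h.dressed i)
      rw [map_mul, map_mul, mul_assoc, ← hd, ← mul_assoc, ← map_mul, Units.inv_mul, map_one,
        one_mul]
    rw [e]
    exact Subtype.prop _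
  have hG : ∀ i, (∀ I a b, genMat (FCon R m) FGen.N i I a b ∈ S) →
      ∀ I a b, genMat (FCon R m) FGen.Np i I a b ∈ S ∧ genMat (FCon R m) FGen.Nm i I a b ∈ S :=
    fun i hi => hS _ _ _ hi (hL.self i) (hL.gauss i)
  have hK : ∀ r, ∃ U : (Mono d S)ˣ, mapMono S.val U.val = gauge (genMat (FCon R m) FGen.Nm) r := by
    intro r
    induction r using Fin.induction with
    | zero => exact ⟨1, by rw [Units.val_one, map_one, gauge_zero]⟩
    | succ i ih =>
      obtain ⟨U, hU⟩ := ih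
      obtain ⟨V, hV⟩ := (hL.gauss i).exists_unit_subalgebra (hG i (hN i U hU))
      exact ⟨U * V, by rw [Units.val_mul, map_mul, hU, hV, gauge_succ]⟩
  have hN' := fun i => (hK i.castSucc).elim (hN i)
  exact fAlg_subalgebra_eq_top hM' hN' (fun i I a b => (hG i (hN' i) I a b).1)
    fun i I a b => (hG i (hN' i) I a b).2

theorem inverse_mono_apply {K : Mono d A} (hK : IsUnit K) (I : 𝔍) :
    Ring.inverse (K I) = Ring.inverse K I := by
  obtain ⟨u, rfl⟩ := hK
  rw [Ring.inverse_unit]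
  exact Ring.inverse_unit (Units.map (Pi.evalMonoidHom _ I) u)

/-- Sending `L_i` to the dressed monodromy `N_i` identifies `ℒ_m` with `ℱ_{0,m}`; the inverse
sends `M_i` to `K_i L_i K_i⁻¹`. -/
theorem exists_bijective_hom (R : RFamily k d) (m : ℕ) :
    ∃ f : LAlg R m →ₐ[k] FAlg R m, Function.Bijective f ∧ ∀ i,
      mapMono f (matK R m i.castSucc * matL R m i * Ring.inverse (matK R m i.castSucc))
        = matM R m i := by
  have hL := lRelations_mat R m
  have hF := fRelations_mat R m
  have hK : ∀ r, IsUnit (matK R m r) := isUnit_gauge fun i => (hL.gauss i).isUnit_lower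
  obtain ⟨f, hf⟩ := exists_lAlg_hom hF.lRelations
  obtain ⟨g, hg⟩ := exists_fAlg_hom (hL.fRelations
    (M := fun i => matK R m i.castSucc * matL R m i * Ring.inverse (matK R m i.castSucc))
    fun i => (Ring.inverse_mul_cancel_right _ _ (hK _)).symm)
  have hgf : g.comp f = AlgHom.id k _ := by
    have map_comp : ∀ X : Mono d (LAlg R m), mapMono (g.comp f) X = mapMono g (mapMono f X) :=
      fun _ => rfl
    have map_id : ∀ X : Mono d (LAlg R m), mapMono (AlgHom.id k (LAlg R m)) X = X := fun _ => rfl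
    refine lAlg_hom_ext (fun i => ?_) (fun i => ?_) fun i => ?_
    · rw [map_comp, map_id, (hf i).1, (hg i).2.1]
    · rw [map_comp, map_id, (hf i).2.1, (hg i).2.2.1]
    · rw [map_comp, map_id, (hf i).2.2, (hg i).2.2.2]
  have hfK : ∀ r, mapMono f (matK R m r) = gauge (genMat (FCon R m) FGen.Nm) r := fun r => by
    rw [matK, ← gauge_mapMono]
    exact congrArg (fun Y => gauge Y r) (funext fun i => (hf i).2.2)
  have hfM : ∀ i, mapMono f (matK R m i.castSucc * matL R m i *
      Ring.inverse (matK R m i.castSucc)) = matM R m i := fun i => by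
    have hd : gauge (genMat (FCon R m) FGen.Nm) i.castSucc * genMat (FCon R m) FGen.N i
        = matM R m i * gauge (genMat (FCon R m) FGen.Nm) i.castSucc := funext (hF.dressed i)
    rw [← ((hK i.castSucc).map (mapMono f)).mul_left_inj, ← map_mul,
      Ring.inverse_mul_cancel_right _ _ (hK _), map_mul, hfK, (hf i).1, hd]
  refine ⟨f, ⟨fun x y hxy => ?_, ?_⟩, hfM⟩
  · have := congrArg g hxy
    rwa [← AlgHom.comp_apply, ← AlgHom.comp_apply, hgf] at this
  · rw [← AlgHom.range_eq_top]
    refine fAlg_subalgebra_eq_top (fun i I a b => ?_) (fun i I a b => ?_) (fun i I a b => ?_)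
      fun i I a b => ?_
    · rw [← hfM i]; exact ⟨_, rfl⟩
    · rw [← (hf i).1]; exact ⟨_, rfl⟩
    · rw [← (hf i).2.1]; exact ⟨_, rfl⟩
    · rw [← (hf i).2.2]; exact ⟨_, rfl⟩

/-- The XXZ `L`-operator is `L_+ + z L_- = (L + z) L_-`, so the gauge transformation with
`K_i` on the left and `K_{i+1} = K_i L_-` on the right gives `K_i (L + z) K_i⁻¹`. -/
theorem mul_pencil_mul_inverse {n : Type*} [Fintype n] [DecidableEq n]
    {K K' X Xp Xm : Matrix n n A} (hK : IsUnit K) (hK' : IsUnit K') (hX : X * Xm = Xp)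
    (hs : K' = K * Xm) (z : k) :
    K * (Xp + z • Xm) * Ring.inverse K' = K * X * Ring.inverse K + z • 1 := by
  symm
  rw [Ring.eq_mul_inverse_iff_mul_eq _ _ _ hK', hs, add_mul, ← mul_assoc,
    Ring.inverse_mul_cancel_right _ _ hK, mul_assoc, hX, mul_add, smul_mul_assoc, one_mul,
    mul_smul_comm]

end Generation

end ChernSimons

open ChernSimons in
theorem theorem3 {k : Type*} [CommRing k] {𝔍 : Type*} {d : 𝔍 → ℕ} (R : RFamily k d)
    (n g : ℕ) :
    (∀ i I, IsUnit (matLm R (n + 2 * g) i I) ∧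
      matL R (n + 2 * g) i I
        = matLp R (n + 2 * g) i I * Ring.inverse (matLm R (n + 2 * g) i I)) ∧
    (∀ r I, IsUnit (matK R (n + 2 * g) r I)) ∧
    ∃ Φ : LAlg R (n + 2 * g) ≃ₐ[k] monodromySubalgebra R (n + 2 * g),
      (∀ i I, matM R (n + 2 * g) i I
        = (matK R (n + 2 * g) i.castSucc I * matL R (n + 2 * g) i I
            * Ring.inverse (matK R (n + 2 * g) i.castSucc I)).map
            (fun x => (Φ x : FAlg R (n + 2 * g)))) ∧
      (∀ i I (z : k), spectralM R (n + 2 * g) i z I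
        = (matK R (n + 2 * g) i.castSucc I * xxzL R (n + 2 * g) i z I
            * Ring.inverse (matK R (n + 2 * g) i.succ I)).map
            (fun x => (Φ x : FAlg R (n + 2 * g)))) := by
  generalize n + 2 * g = m
  have hL := lRelations_mat R m
  have hm : ∀ i, IsUnit (matLm R m i) := fun i => (hL.gauss i).isUnit_lower
  have hK : ∀ r, IsUnit (matK R m r) := isUnit_gauge hm
  have hmI := fun i => Pi.isUnit_iff.1 (hm i)
  have hKI := fun r => Pi.isUnit_iff.1 (hK r)
  obtain ⟨f, hf, hM⟩ := exists_bijective_hom R m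
  refine ⟨fun i I => ⟨hmI i I, (Ring.eq_mul_inverse_iff_mul_eq _ _ _ (hmI i I)).2
    ((hL.gauss i).factor I)⟩, hKI,
    ((AlgEquiv.ofBijective f hf).trans Subalgebra.topEquiv.symm).trans
      (Subalgebra.equivOfEq _ _ (monodromySubalgebra_eq_top R m).symm), fun i I => ?_,
    fun i I z => ?_⟩
  · rw [← hM i, inverse_mono_apply (hK _)]
    rfl
  · have e : matK R m i.castSucc I * xxzL R m i z I * Ring.inverse (matK R m i.succ I)
        = matK R m i.castSucc I * matL R m i I * Ring.inverse (matK R m i.castSucc I) + z • 1 :=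
      mul_pencil_mul_inverse (hKI _ I) (hKI _ I) ((hL.gauss i).factor I)
        (congrFun (gauge_succ (matLm R m) i) I) z
    rw [e, spectralM, ← hM i, inverse_mono_apply (hK _)]
    ext a b
    refine Eq.trans ?_ (map_add f _ _).symm
    refine congrArg (mapMono f (matK R m i.castSucc * matL R m i *
      Ring.inverse (matK R m i.castSucc)) I a b + ·) ?_
    simp [Matrix.one_apply, apply_ite f]
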